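/- Let \(\ell\ge 1\) be an integer, let \((G,+)\) be a countable discrete abelian group, and let \((T_g)_{g\in G}\) be a measure preserving action of \(G\) on a separable probability space \((X,\mathcal A,\mu)\). A sequence \((g_k)_{k\in\mathbb N}\) in \(G\) satisfies \(\lim_{k\to\infty}g_k=\infty\) if it eventually leaves every finite subset of \(G\); sequences \((g_k)\) and \((h_k)\) in \(G\) grow apart if \(\lim_{k\to\infty}(g_k-h_k)=\infty\). The action is strongly mixing if \(\lim_{g\to\infty}\mu(A_0\cap T_gA_1)=\mu(A_0)\mu(A_1)\) for all \(A_0,A_1\in\mathcal A\). A sequence \((\mathbf g_k)_k=(g_{k,1},\dots,g_{k,d})_k\) in \(G^d\) is non-degenerated if \(\lim_{k\to\infty}g_{k,t}=\infty\) for every \(t\in\{1,\dots,d\}\). Two sequences \((\mathbf g_k)_k\), \((\mathbf h_k)_k\) in \(G^d\) are essentially distinct if for every \(t\in\{1,\dots,d\}\) the sequences \((g_{k,t})_k\) and \((h_{k,t})_k\) grow apart. For \(S\subseteq\mathbb N\), \(S^{(m)}\) denotes the family of \(m\)-element subsets of \(S\). For a sequence \((\mathbf g_k)_k\) in \(G^m\)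 and \(\alpha=\{k_1<\dots<k_m\}\in\mathbb N^{(m)}\) put \(g_\alpha=g_{k_1,1}+\dots+g_{k_m,m}\). For an infinite \(S\subseteq\mathbb N\), real numbers \((x_\alpha)_{\alpha\in\mathbb N^{(m)}}\) and \(x\in\mathbb R\), write \(\mathcal R\text{-}\lim_{\alpha\in S^{(m)}}x_\alpha=x\) if for every \(\epsilon>0\) there is \(\alpha_0\in\mathbb N^{(m)}\) such that \(|x_\alpha-x|<\epsilon\) for every \(\alpha\in S^{(m)}\) with \(\min\alpha>\max\alpha_0\). A \(\Sigma_m\) set in \(G\) is a set of the form \(\{g^{(1)}_{k_1}+\dots+g^{(m)}_{k_m} : k_1<\dots<k_m\}\), where \((g^{(j)}_k)_k\), \(1\le j\le m\), are sequences in \(G\) with \(\lim_{k\to\infty}g^{(j)}_k=\infty\). A \(\tilde\Sigma_m\) set in \(G^d\) is a set of the form \(\{\mathbf g^{(1)}_{k_1}+\dots+\mathbf g^{(m)}_{k_m} : k_1<\dots<k_m\}\), where, for each \(j\in\{1,\dots,m\}\), \((\mathbf g^{(j)}_k)_k\) is a non-degenerated sequence in \(G^d\) any two distinct coordinate sequences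 \((g^{(j)}_{k,t})_k\), \((g^{(j)}_{k,t'})_k\) of which grow apart. A subset of \(G\) is \(\Sigma_m^*\) if it meets every \(\Sigma_m\) set in \(G\); a subset of \(G^d\) is \(\tilde\Sigma_m^*\) if it meets every \(\tilde\Sigma_m\) set in \(G^d\). For \(n\ge1\), \(\epsilon>0\) and \(A_0,\dots,A_n\in\mathcal A\) let \[R_\epsilon(A_0,\dots,A_n)=\Big\{(g_1,\dots,g_n)\in G^n : \Big|\mu(A_0\cap T_{g_1}A_1\cap\dots\cap T_{g_n}A_n)-\prod_{j=0}^n\mu(A_j)\Big|<\epsilon\Big\}.\] Then the following four statements are equivalent. (i) \((T_g)_{g\in G}\) is strongly mixing. (ii) For any \(\ell\) non-degenerated and pairwise essentially distinct sequences \((\mathbf g^{(j)}_k)_{k\in\mathbb N}=(g^{(j)}_{k,1},\dots,g^{(j)}_{k,\ell})_{k\in\mathbb N}\), \(j\in\{1,\dots,\ell\}\), in \(G^\ell\), there is an infinite set \(S\subseteq\mathbb N\) such that for all \(A_0,\dots,A_\ell\in\mathcal A\) \[\mathop{\mathcal R\text{-}\lim}_{\alpha\in S^{(\ell)}}\mu\big(A_0\cap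 T_{g^{(1)}_\alpha}A_1\cap\dots\cap T_{g^{(\ell)}_\alpha}A_\ell\big)=\prod_{j=0}^\ell\mu(A_j).\] (iii) For every \(\epsilon>0\) and all \(A_0,\dots,A_\ell\in\mathcal A\), the set \(R_\epsilon(A_0,\dots,A_\ell)\) is \(\tilde\Sigma_\ell^*\) in \(G^\ell\). (iv) For every \(\epsilon>0\) and all \(A_0,A_1\in\mathcal A\), the set \(R_\epsilon(A_0,A_1)\) is \(\Sigma_\ell^*\) in \(G\). -/

import Mathlib

open Filter Topology MeasureTheory
open scoped Pointwise

/-- `lim_{k → ∞} g_k = ∞` in the discrete group `G`: the sequence eventually leaves every finite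
subset of `G`. -/
def GoesToInfinity {G : Type*} (g : ℕ → G) : Prop :=
  Tendsto g atTop cofinite

/-- Two sequences in `G` grow apart if `lim_{k → ∞} (g_k - h_k) = ∞`. -/
def GrowApart {G : Type*} [AddCommGroup G] (g h : ℕ → G) : Prop :=
  GoesToInfinity (fun k => g k - h k)

/-- A sequence `(g_{k,1}, …, g_{k,d})_k` in `G ^ d` is non-degenerated if each of its coordinate
sequences goes to infinity. -/
def NonDegenerated {G : Type*} {d : ℕ} (g : ℕ → Fin d → G) : Prop :=
  ∀ t : Fin d, GoesToInfinity (fun k => g k t)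

/-- Two sequences in `G ^ m` are essentially distinct if they grow apart in each coordinate. -/
def EssentiallyDistinct {G : Type*} [AddCommGroup G] {m : ℕ} (g h : ℕ → Fin m → G) : Prop :=
  ∀ t : Fin m, GrowApart (fun k => g k t) (fun k => h k t)

/-- `ℕ^(m)`, the family of all `m`-element subsets `{k_1 < ⋯ < k_m}` of `ℕ`, each of them being
represented by its increasing enumeration. -/
abbrev NatSubsets (m : ℕ) : Type := Fin m ↪o ℕ

/-- The element `g_α = g_{k_1,1} + ⋯ + g_{k_m,m}` attached to a sequence in `G ^ m` and to
`α = {k_1 < ⋯ < k_m}`. -/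
def indexSum {G : Type*} [AddCommGroup G] {m : ℕ} (g : ℕ → Fin m → G) (α : NatSubsets m) : G :=
  ∑ t : Fin m, g (α t) t

/-- `R-lim_{α ∈ S^(m)} x_α = y`: for every `ε > 0` there is `α₀ ∈ ℕ^(m)` such that
`d(x_α, y) < ε` for every `α ∈ S^(m)` with `min α > max α₀`. -/
def IsRLim {Y : Type*} [MetricSpace Y] {m : ℕ} (S : Set ℕ) (x : NatSubsets m → Y) (y : Y) : Prop :=
  ∀ ε : ℝ, 0 < ε → ∃ α₀ : NatSubsets m, ∀ α : NatSubsets m,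
    (∀ i, α i ∈ S) → (∀ i j, α₀ i < α j) → dist (x α) y < ε

/-- `Σ_m` sets in `G`. -/
def IsSigmaSet {G : Type*} [AddCommGroup G] (m : ℕ) (E : Set G) : Prop :=
  ∃ g : Fin m → ℕ → G, (∀ j, GoesToInfinity (g j)) ∧
    E = {x | ∃ k : NatSubsets m, x = ∑ j, g j (k j)}

/-- `Σ_m^*` sets in `G`. -/
def IsSigmaStarSet {G : Type*} [AddCommGroup G] (m : ℕ) (E : Set G) : Prop :=
  ∀ D : Set G, IsSigmaSet m D → (E ∩ D).Nonempty

/-- `Σ̃_m` sets in `G ^ d`. -/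
def IsSigmaTildeSet {G : Type*} [AddCommGroup G] {d : ℕ} (m : ℕ) (E : Set (Fin d → G)) : Prop :=
  ∃ g : Fin m → ℕ → Fin d → G, (∀ j, NonDegenerated (g j)) ∧
    (∀ j, ∀ t t' : Fin d, t ≠ t' → GrowApart (fun k => g j k t) (fun k => g j k t')) ∧
    E = {x | ∃ k : NatSubsets m, x = ∑ j, g j (k j)}

/-- `Σ̃_m^*` sets in `G ^ d`. -/
def IsSigmaTildeStarSet {G : Type*} [AddCommGroup G] {d : ℕ} (m : ℕ)
    (E : Set (Fin d → G)) : Prop :=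
  ∀ D : Set (Fin d → G), IsSigmaTildeSet m D → (E ∩ D).Nonempty

/-- The action `T_g x = g +ᵥ x` of `G` on `(X, μ)` is strongly mixing. -/
def StronglyMixing (G : Type*) [AddCommGroup G] {X : Type*} [MeasurableSpace X] [AddAction G X]
    (μ : Measure X) : Prop :=
  ∀ A₀ A₁ : Set X, MeasurableSet A₀ → MeasurableSet A₁ →
    Tendsto (fun g : G => μ.real (A₀ ∩ (g +ᵥ A₁))) cofinite (𝓝 (μ.real A₀ * μ.real A₁))

/-- The number `μ(A_0 ∩ T_{g_1} A_1 ∩ ⋯ ∩ T_{g_ℓ} A_ℓ)`. -/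
noncomputable def multiCorrelation {G : Type*} [AddCommGroup G] {X : Type*} [MeasurableSpace X]
    [AddAction G X] (μ : Measure X) {ℓ : ℕ} (A : Fin (ℓ + 1) → Set X) (g : Fin ℓ → G) : ℝ :=
  μ.real (A 0 ∩ ⋂ j : Fin ℓ, (g j +ᵥ A j.succ))

/-- The set `R_ε(A_0, …, A_ℓ) ⊆ G ^ ℓ`. -/
def mixingSet (G : Type*) [AddCommGroup G] {X : Type*} [MeasurableSpace X] [AddAction G X]
    (μ : Measure X) {ℓ : ℕ} (ε : ℝ) (A : Fin (ℓ + 1) → Set X) : Set (Fin ℓ → G) :=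
  {g | |multiCorrelation μ A g - ∏ j, μ.real (A j)| < ε}

/-!
All limits are taken along the hyperfilter on `ℕ` and its iterated tensor powers
`tupleUltrafilter m`, for which `(k_1, …, k_m)` ranges over most `k_1`, then most `k_2`, and so on.
Such limits are related to increasing tuples from an infinite subset of `ℕ` by a Ramsey-type
diagonal extraction, `exists_strictMono_forall_tuple`: countably many large sets of tuples share an
infinite set all of whose increasing tuples, up to a restriction on the minimum, they contain.

The analytic input is a van der Corput trick, `tendsto_zero_of_sq_sum_le`: by Cauchy–Schwarz, sets
that are asymptotically pairwise independent become asymptotically independent of any fixed set.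

*Mixing implies `R`-limits.* Consider `m + 1` sets translated by sums `∑ t, h j t (k_t)`, the first
of which may be taken stationary. Two copies of the remaining intersection, with different first
indices `k, k'` and the same other indices, meet in an intersection of `m` translates of the sets
`T_{b_j(k)} A_j ∩ T_{b_j(k')} A_j`. By induction its measure tends to the product of theirs, which
tends to `∏ μ(A_j)²` as `k'` grows since the action mixes. The van der Corput trick then gives
`StronglyMixing.tendsto_tupleUltrafilter`. The extraction along a countable measure-dense family of
sets turns this into a statement about `R`-limits (`StronglyMixing.exists_isRLim`).

*`R`-limits imply the `Σ̃_ℓ^*` and `Σ_ℓ^*` properties.* The first implication is a transposition of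
indices. For the second, `A₀` and `A₁` are padded with copies of the whole space, and the given
sequences are completed by auxiliary ones that grow apart (`GoesToInfinity.exists_nonDegenerated`).

*The `Σ_ℓ^*` property implies mixing.* By the extraction, the action mixes along every sum
`p_1 + ⋯ + p_ℓ` of ultrafilters on `G` coming from sequences going to infinity. Mixing along `r`
implies mixing along `p + r`, and mixing along `-r + r` implies mixing along `r` by the van der
Corput trick. As `-r + r` has `2m ≥ m + 1` summands when `r` has `m ≥ 1`, the number of summands can
be lowered to one, and this is strong mixing.
-/

/-! ### A van der Corput trick -/

/-- One-sided form of `tendsto_zero_of_sq_sum_le`. -/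
theorem eventually_lt_of_sq_sum_le {ι : Type*} {q : Filter ι} {y : ι → ℝ} {D : ι → ι → ℝ} {C : ℝ}
    (hsymm : ∀ i j, D i j = D j i) (hC : ∀ i, D i i ≤ C)
    (hsq : ∀ (s : ℕ → ι) (N : ℕ), (∑ i ∈ Finset.range N, y (s i)) ^ 2 ≤
      ∑ i ∈ Finset.range N, ∑ j ∈ Finset.range N, D (s i) (s j))
    (hD : ∀ ε > 0, ∀ᶠ i in q, ∀ᶠ j in q, D i j < ε) {ε : ℝ} (hε : 0 < ε) :
    ∀ᶠ i in q, y i < ε := by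
  by_contra hfreq
  replace hfreq : ∃ᶠ i in q, ε ≤ y i := by
    simpa only [Filter.Frequently, not_le] using hfreq
  set δ : ℝ := ε ^ 2 / 2
  have hδ : 0 < δ := by positivity
  -- an infinite sequence of indices with `ε ≤ y` and pairwise small correlations
  obtain ⟨s, hs, hss⟩ := exists_seq_of_forall_finset_exists
    (fun i => ε ≤ y i ∧ ∀ᶠ j in q, D i j < δ) (fun i j => D i j < δ) (by
      intro F hF
      have h1 : ∀ᶠ j in q, ∀ i ∈ F, D i j < δ :=
        (Filter.eventually_all_finset F).2 fun i hi => (hF i hi).2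
      obtain ⟨j, hj, hj1, hj2⟩ := (hfreq.and_eventually ((hD δ hδ).and h1)).exists
      exact ⟨j, ⟨hj, hj1⟩, hj2⟩)
  obtain ⟨N, hN⟩ := exists_nat_gt (|C| / δ)
  have hN0 : (0 : ℝ) < N := lt_of_le_of_lt (by positivity) hN
  have hlow : (N * ε) ^ 2 ≤ (∑ i ∈ Finset.range N, y (s i)) ^ 2 := by
    have : N * ε ≤ ∑ i ∈ Finset.range N, y (s i) := by
      simpa using Finset.card_nsmul_le_sum (Finset.range N) (fun i => y (s i)) ε
        fun i _ => (hs i).1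
    gcongr
  have hup : ∑ i ∈ Finset.range N, ∑ j ∈ Finset.range N, D (s i) (s j) ≤ N * (N * δ + |C|) := by
    have hrow : ∀ i ∈ Finset.range N,
        ∑ j ∈ Finset.range N, D (s i) (s j) ≤ N * δ + |C| := by
      intro i hi
      calc ∑ j ∈ Finset.range N, D (s i) (s j)
          ≤ ∑ j ∈ Finset.range N, (δ + if i = j then |C| else 0) := by
            refine Finset.sum_le_sum fun j _ => ?_
            rcases lt_trichotomy i j with h | rfl | h
            · simpa [h.ne] using (hss i j h).le
            · simpa using ((hC (s i)).trans (le_abs_self C)).trans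
                (le_add_of_nonneg_left hδ.le)
            · simpa [h.ne', hsymm (s i)] using (hss j i h).le
        _ = N * δ + |C| := by
            rw [Finset.sum_add_distrib, Finset.sum_ite_eq, if_pos hi]; simp
    simpa only [Finset.card_range, nsmul_eq_mul] using Finset.sum_le_card_nsmul _ _ _ hrow
  have hchain := (hlow.trans (hsq s N)).trans hup
  rw [div_lt_iff₀ hδ] at hN
  have : (N : ℝ) * |C| < N * (N * δ) := by gcongr
  have h2 : ((N : ℝ) * ε) ^ 2 = N * (2 * (N * δ)) := by simp only [δ]; ring
  rw [h2] at hchain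
  nlinarith

/-- **Van der Corput trick.** If a Gram-type matrix `D` dominates the squares of the partial sums
of `y`, and `D i j` is small for `q`-most `i` and then `q`-most `j`, then `y` tends to zero. -/
theorem tendsto_zero_of_sq_sum_le {ι : Type*} {q : Filter ι} {y : ι → ℝ} {D : ι → ι → ℝ} {C : ℝ}
    (hsymm : ∀ i j, D i j = D j i) (hC : ∀ i, D i i ≤ C)
    (hsq : ∀ (s : ℕ → ι) (N : ℕ), (∑ i ∈ Finset.range N, y (s i)) ^ 2 ≤
      ∑ i ∈ Finset.range N, ∑ j ∈ Finset.range N, D (s i) (s j))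
    (hD : ∀ ε > 0, ∀ᶠ i in q, ∀ᶠ j in q, D i j < ε) :
    Tendsto y q (𝓝 0) := by
  rw [Metric.tendsto_nhds]
  intro ε hε
  have h1 := eventually_lt_of_sq_sum_le hsymm hC hsq hD hε
  have h2 := eventually_lt_of_sq_sum_le (y := fun i => - y i) hsymm hC
    (by simpa only [Finset.sum_neg_distrib, neg_sq] using hsq) hD hε
  filter_upwards [h1, h2] with i hi1 hi2
  rw [Real.dist_eq, sub_zero, abs_lt]
  constructor <;> linarith

/-- The Cauchy–Schwarz inequality for `1_A` and `∑ i, (1_{U i} - c)`. -/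
theorem sq_sum_measureReal_inter_sub_le {X : Type*} [MeasurableSpace X] (μ : Measure X)
    [IsProbabilityMeasure μ] {A : Set X} (hA : MeasurableSet A) {U : ℕ → Set X}
    (hU : ∀ i, MeasurableSet (U i)) (c : ℝ) (N : ℕ) :
    (∑ i ∈ Finset.range N, (μ.real (A ∩ U i) - μ.real A * c)) ^ 2 ≤
      ∑ i ∈ Finset.range N, ∑ j ∈ Finset.range N,
        (μ.real (U i ∩ U j) - c * μ.real (U i) - c * μ.real (U j) + c ^ 2) := by
  have hint : ∀ {B : Set X}, MeasurableSet B → Integrable (B.indicator (1 : X → ℝ)) μ :=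
    fun hB => (integrable_const (1 : ℝ)).indicator hB
  set F : X → ℝ := fun x => ∑ i ∈ Finset.range N, ((U i).indicator 1 x - c) with hF
  have hmul : ∀ (B D : Set X) (x : X),
      B.indicator (1 : X → ℝ) x * D.indicator 1 x = (B ∩ D).indicator 1 x := fun B D x =>
    (congrFun (Set.inter_indicator_one (M₀ := ℝ) (s := B) (t := D)) x).symm
  have hAF : ∀ x, A.indicator (1 : X → ℝ) x * F x =
      ∑ i ∈ Finset.range N, ((A ∩ U i).indicator 1 x - A.indicator 1 x * c) := by
    intro x
    simp only [hF, Finset.mul_sum, mul_sub, hmul]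
  have hFF : ∀ x, F x ^ 2 = ∑ i ∈ Finset.range N, ∑ j ∈ Finset.range N,
      ((U i ∩ U j).indicator (1 : X → ℝ) x - c * (U i).indicator 1 x
        - c * (U j).indicator 1 x + c ^ 2) := by
    intro x
    simp only [hF, sq, Finset.sum_mul_sum, ← hmul]
    refine Finset.sum_congr rfl fun i _ => Finset.sum_congr rfl fun j _ => by ring
  have iAF1 : ∀ i, Integrable
      (fun x => (A ∩ U i).indicator (1 : X → ℝ) x - A.indicator 1 x * c) μ := fun i =>
    (hint (hA.inter (hU i))).sub ((hint hA).mul_const c)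
  have iAF : Integrable (fun x => A.indicator (1 : X → ℝ) x * F x) μ := by
    simp only [hAF]
    exact integrable_finsetSum _ fun i _ => iAF1 i
  have iFF1 : ∀ i j, Integrable (fun x => (U i ∩ U j).indicator (1 : X → ℝ) x
      - c * (U i).indicator 1 x - c * (U j).indicator 1 x + c ^ 2) μ := fun i j =>
    (((hint ((hU i).inter (hU j))).sub ((hint (hU i)).const_mul c)).sub
      ((hint (hU j)).const_mul c)).add (integrable_const _)
  have iFF : Integrable (fun x => F x ^ 2) μ := by
    simp only [hFF]
    exact integrable_finsetSum _ fun i _ => integrable_finsetSum _ fun j _ => iFF1 i j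
  have eAF : ∫ x, A.indicator (1 : X → ℝ) x * F x ∂μ =
      ∑ i ∈ Finset.range N, (μ.real (A ∩ U i) - μ.real A * c) := by
    simp only [hAF]
    rw [integral_finsetSum _ fun i _ => iAF1 i]
    refine Finset.sum_congr rfl fun i _ => ?_
    rw [integral_sub (hint (hA.inter (hU i))) ((hint hA).mul_const c), integral_mul_const,
      integral_indicator_one (hA.inter (hU i)), integral_indicator_one hA]
  have eFF : ∫ x, F x ^ 2 ∂μ = ∑ i ∈ Finset.range N, ∑ j ∈ Finset.range N,
        (μ.real (U i ∩ U j) - c * μ.real (U i) - c * μ.real (U j) + c ^ 2) := by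
    simp only [hFF]
    rw [integral_finsetSum _ fun i _ => integrable_finsetSum _ fun j _ => iFF1 i j]
    refine Finset.sum_congr rfl fun i _ => ?_
    rw [integral_finsetSum _ fun j _ => iFF1 i j]
    refine Finset.sum_congr rfl fun j _ => ?_
    have i1 := hint ((hU i).inter (hU j))
    have i2 := (hint (hU i)).const_mul c
    have i3 := (hint (hU j)).const_mul c
    have i12 : Integrable (fun x => (U i ∩ U j).indicator (1 : X → ℝ) x
      - c * (U i).indicator 1 x) μ := i1.sub i2
    have i123 : Integrable (fun x => (U i ∩ U j).indicator (1 : X → ℝ) x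
      - c * (U i).indicator 1 x - c * (U j).indicator 1 x) μ := i12.sub i3
    rw [integral_add i123 (integrable_const _), integral_sub i12 i3, integral_sub i1 i2,
      integral_const_mul, integral_const_mul,
      integral_indicator_one ((hU i).inter (hU j)), integral_indicator_one (hU i),
      integral_indicator_one (hU j)]
    simp
  rw [← eAF, ← eFF]
  set a := ∫ x, A.indicator (1 : X → ℝ) x * F x ∂μ
  have key : 0 ≤ ∫ x, (F x - a * A.indicator 1 x) ^ 2 ∂μ :=
    integral_nonneg fun x => sq_nonneg _
  have hexp : ∀ x, (F x - a * A.indicator 1 x) ^ 2 =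
      F x ^ 2 - 2 * a * (A.indicator 1 x * F x) + a ^ 2 * A.indicator 1 x := by
    intro x
    have := hmul A A x
    rw [Set.inter_self] at this
    linear_combination a ^ 2 * this
  simp only [hexp] at key
  have iFA : Integrable (fun x => F x ^ 2 - 2 * a * (A.indicator (1 : X → ℝ) x * F x)) μ :=
    iFF.sub (iAF.const_mul _)
  rw [integral_add iFA ((hint hA).const_mul _),
    integral_sub iFF (iAF.const_mul _), integral_const_mul, integral_const_mul,
    integral_indicator_one hA] at key
  have hA1 : μ.real A ≤ 1 := measureReal_le_one
  nlinarith [mul_le_mul_of_nonneg_left hA1 (sq_nonneg a)]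

/-! ### Iterated ultrafilter limits -/

/-- The `m`-fold tensor power of the hyperfilter on `ℕ`: a set of tuples is large if
`(k_1, …, k_m)` lies in it for most `k_1`, then most `k_2`, …, then most `k_m`. -/
noncomputable def tupleUltrafilter : (m : ℕ) → Ultrafilter (Fin m → ℕ)
  | 0 => pure Fin.elim0
  | m + 1 => (hyperfilter ℕ).bind fun k => (tupleUltrafilter m).map (Fin.cons k)

theorem eventually_tupleUltrafilter_succ {m : ℕ} {P : (Fin (m + 1) → ℕ) → Prop} :
    (∀ᶠ v in (tupleUltrafilter (m + 1) : Filter (Fin (m + 1) → ℕ)), P v) ↔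
      ∀ᶠ k in (hyperfilter ℕ : Filter ℕ),
        ∀ᶠ v in (tupleUltrafilter m : Filter (Fin m → ℕ)), P (Fin.cons k v) :=
  Iff.rfl

theorem eventually_lt_hyperfilter (K : ℕ) : ∀ᶠ k in (hyperfilter ℕ : Filter ℕ), K < k :=
  Nat.hyperfilter_le_atTop (eventually_gt_atTop K)

theorem eventually_strictMono_tupleUltrafilter (m K : ℕ) :
    ∀ᶠ v in (tupleUltrafilter m : Filter (Fin m → ℕ)), StrictMono v ∧ ∀ i, K < v i := by
  induction m generalizing K with
  | zero => exact Eventually.of_forall fun v => ⟨fun i => i.elim0, fun i => i.elim0⟩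
  | succ m ih =>
    rw [eventually_tupleUltrafilter_succ]
    filter_upwards [eventually_lt_hyperfilter K] with k hk
    filter_upwards [ih k] with v hv
    refine ⟨?_, Fin.cases hk fun i => hk.trans (hv.2 i)⟩
    intro i j hij
    induction j using Fin.cases with
    | zero => exact absurd hij (Fin.not_lt_zero i)
    | succ j =>
      induction i using Fin.cases with
      | zero => simpa using hv.2 j
      | succ i => simpa using hv.1 (Fin.succ_lt_succ_iff.1 hij)

/-- `EventuallyExtends D m t`: inserting `m` further elements into `t`, one after the other, gives
a set in `D` for most choices of the first one, then most choices of the second one, and so on. -/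
def EventuallyExtends (D : Finset ℕ → Prop) : ℕ → Finset ℕ → Prop
  | 0, t => D t
  | m + 1, t => ∀ᶠ k in (hyperfilter ℕ : Filter ℕ), EventuallyExtends D m (insert k t)

theorem eventuallyExtends_of_eventually {D : Finset ℕ → Prop} {m : ℕ} {t : Finset ℕ}
    (h : ∀ᶠ v in (tupleUltrafilter m : Filter (Fin m → ℕ)), D (t ∪ Finset.univ.image v)) :
    EventuallyExtends D m t := by
  induction m generalizing t with
  | zero =>
    obtain ⟨v, hv⟩ := h.exists
    simpa [EventuallyExtends] using hv
  | succ m ih =>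
    rw [eventually_tupleUltrafilter_succ] at h
    refine h.mono fun k hk => ih ?_
    refine hk.mono fun v hv => ?_
    convert hv using 1
    ext x
    simp [Fin.exists_fin_succ, eq_comm]
    tauto

/-- A sequence each of whose terms is chosen in a large set depending on the previous terms. -/
theorem exists_strictMono_forall_image_range {U : Finset ℕ → ℕ → Prop}
    (hU : ∀ F, ∀ᶠ k in (hyperfilter ℕ : Filter ℕ), U F k) :
    ∃ s : ℕ → ℕ, StrictMono s ∧ ∀ i, U ((Finset.range i).image s) (s i) := by
  have hU' : ∀ F : Finset ℕ, ∃ k, U F k ∧ ∀ x ∈ F, x < k := fun F =>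
    ((hU F).and ((Filter.eventually_all_finset F).2
      fun x _ => eventually_lt_hyperfilter x)).exists
  choose c hc hcF using hU'
  let H : ℕ → Finset ℕ := fun n => n.rec ∅ fun _ F => insert (c F) F
  have hH : ∀ n, H n = (Finset.range n).image fun i => c (H i) := by
    intro n
    induction n with
    | zero => rfl
    | succ n ih =>
      rw [Finset.range_add_one, Finset.image_insert, ← ih]
  refine ⟨fun i => c (H i), strictMono_nat_of_lt_succ fun n => hcF _ _ ?_, fun i => ?_⟩
  · exact Finset.mem_insert_self _ _
  · rw [← hH]
    exact hc _

/-- A Ramsey-type diagonal extraction: countably many large sets of `m`-tuples contain, each up to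
a restriction on the minimum, all increasing `m`-tuples from one common infinite set. -/
theorem exists_strictMono_forall_tuple {m : ℕ} {P : ℕ → (Fin m → ℕ) → Prop}
    (hP : ∀ n, ∀ᶠ v in (tupleUltrafilter m : Filter (Fin m → ℕ)), P n v) :
    ∃ s : ℕ → ℕ, StrictMono s ∧ ∀ n (α : Fin m → ℕ), StrictMono α →
      (∀ i, α i ∈ Set.range s) → (∀ i, s n ≤ α i) → P n α := by
  let D : ℕ → Finset ℕ → Prop := fun n t =>
    ∃ v : Fin m → ℕ, StrictMono v ∧ t = Finset.univ.image v ∧ P n v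
  let B : ℕ → Finset ℕ → Prop := fun n t => EventuallyExtends (D n) (m - t.card) t
  have hB0 : ∀ n, B n ∅ := by
    intro n
    have h : EventuallyExtends (D n) m ∅ := by
      refine eventuallyExtends_of_eventually ?_
      filter_upwards [hP n, eventually_strictMono_tupleUltrafilter m 0] with v hv hmono
      exact ⟨v, hmono.1, by simp, hv⟩
    simpa [B] using h
  obtain ⟨s, hs, hsU⟩ := exists_strictMono_forall_image_range
    (U := fun F k => ∀ n ∈ Finset.range (F.card + 1), ∀ t ∈ F.powerset,
      B n t → t.card < m → B n (insert k t)) (by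
      intro F
      refine (Filter.eventually_all_finset _).2 fun n _ =>
        (Filter.eventually_all_finset _).2 fun t _ => ?_
      by_cases ht : B n t ∧ t.card < m
      · obtain ⟨j, hj⟩ : ∃ j, m - t.card = j + 1 := ⟨m - t.card - 1, by omega⟩
        have h1 : EventuallyExtends (D n) (j + 1) t := hj ▸ ht.1
        have h2 : ∀ᶠ k in (hyperfilter ℕ : Filter ℕ), k ∉ t := by
          refine Nat.hyperfilter_le_atTop ?_
          filter_upwards [eventually_gt_atTop (t.sup id)] with k hk hkt
          exact absurd (Finset.le_sup (f := id) hkt) (not_le.2 hk)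
        refine ((show ∀ᶠ k in (hyperfilter ℕ : Filter ℕ),
          EventuallyExtends (D n) j (insert k t) from h1).and h2).mono fun k hk _ _ => ?_
        have : m - (insert k t).card = j := by
          rw [Finset.card_insert_of_notMem hk.2]; omega
        simpa only [B, this] using hk.1
      · exact Eventually.of_forall fun k h1 h2 => absurd ⟨h1, h2⟩ ht)
  have hBt : ∀ n (t : Finset ℕ), (∀ x ∈ t, x ∈ Set.range s) → (∀ x ∈ t, s n ≤ x) →
      t.card ≤ m → B n t := by
    intro n t
    induction t using Finset.induction_on_max with
    | empty => exact fun _ _ _ => hB0 n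
    | insert a t ha ih =>
      intro h1 h2 h3
      rw [Finset.card_insert_of_notMem fun h => lt_irrefl a (ha a h)] at h3
      obtain ⟨i, rfl⟩ := h1 a (Finset.mem_insert_self a t)
      have hni : n ≤ i := hs.le_iff_le.1 (h2 _ (Finset.mem_insert_self _ t))
      refine hsU i n ?_ t ?_ (ih (fun x hx => h1 x (Finset.mem_insert_of_mem hx))
        (fun x hx => h2 x (Finset.mem_insert_of_mem hx)) (by omega)) (by omega)
      · rw [Finset.card_image_of_injective _ hs.injective, Finset.card_range, Finset.mem_range]
        omega
      · rw [Finset.mem_powerset]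
        intro x hx
        obtain ⟨j, rfl⟩ := h1 x (Finset.mem_insert_of_mem hx)
        exact Finset.mem_image_of_mem s (Finset.mem_range.2 (hs.lt_iff_lt.1 (ha _ hx)))
  refine ⟨s, hs, fun n α hα hαs hαn => ?_⟩
  have hcard : (Finset.univ.image α).card = m := by
    rw [Finset.card_image_of_injective _ hα.injective, Finset.card_univ, Fintype.card_fin]
  have hfin : B n (Finset.univ.image α) := hBt n _ (by simpa using hαs) (by simpa using hαn) hcard.le
  simp only [B, hcard, Nat.sub_self] at hfin
  obtain ⟨v, hv, hvα, hPv⟩ := hfin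
  have : α = v := (hα.range_inj hv).1 (by simpa using congrArg (fun t : Finset ℕ => (t : Set ℕ)) hvα)
  exact this ▸ hPv

/-! ### Multiple mixing along iterated limits -/

section Action

variable {G : Type*} [AddCommGroup G] {X : Type*} [MeasurableSpace X] {μ : Measure X}
  [AddAction G X]

theorem measurableSet_vadd_set (hT : ∀ g : G, MeasurePreserving (fun x : X => g +ᵥ x) μ μ) (g : G)
    {A : Set X} (hA : MeasurableSet A) : MeasurableSet (g +ᵥ A) := by
  rw [← Set.preimage_vadd_neg]
  exact (hT (-g)).measurable hA

theorem measureReal_vadd_set (hT : ∀ g : G, MeasurePreserving (fun x : X => g +ᵥ x) μ μ) (g : G)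
    {A : Set X} (hA : MeasurableSet A) : μ.real (g +ᵥ A) = μ.real A := by
  rw [← Set.preimage_vadd_neg]
  exact (hT (-g)).measureReal_preimage hA.nullMeasurableSet

theorem measureReal_vadd_inter_vadd (hT : ∀ g : G, MeasurePreserving (fun x : X => g +ᵥ x) μ μ)
    (a b : G) {A B : Set X} (hA : MeasurableSet A) (hB : MeasurableSet B) :
    μ.real ((a +ᵥ A) ∩ (b +ᵥ B)) = μ.real (A ∩ ((b - a) +ᵥ B)) := by
  rw [← measureReal_vadd_set hT a (hA.inter (measurableSet_vadd_set hT _ hB)),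
    Set.vadd_set_inter, vadd_vadd, add_sub_cancel]

/-- Two-level form of the van der Corput trick: if for sets `U k v` the measures and the pairwise
intersections `U k v ∩ U k' v` are asymptotically (in `v`, then in `k'`) those of independent sets
of measure `c`, then `U k v` becomes independent of every fixed set. -/
theorem tendsto_measureReal_inter_of_pairwise {V : Type*} [IsProbabilityMeasure μ]
    {Q : Ultrafilter V} {q : Filter ℕ} {U : ℕ → V → Set X} (hU : ∀ k v, MeasurableSet (U k v))
    {c : ℝ} {d : ℕ → ℕ → ℝ}
    (h1 : ∀ k, Tendsto (fun v => μ.real (U k v)) Q (𝓝 c))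
    (h2 : ∀ k k', Tendsto (fun v => μ.real (U k v ∩ U k' v)) Q (𝓝 (d k k')))
    (h3 : ∀ k, Tendsto (d k) q (𝓝 (c ^ 2))) {A : Set X} (hA : MeasurableSet A)
    {ε : ℝ} (hε : 0 < ε) :
    ∀ᶠ k in q, ∀ᶠ v in (Q : Filter V), |μ.real (A ∩ U k v) - μ.real A * c| < ε := by
  have hlim : ∀ k, ∃ y, Tendsto (fun v => μ.real (A ∩ U k v) - μ.real A * c) Q (𝓝 y) := by
    intro k
    obtain ⟨y, -, hy⟩ := isCompact_Icc.ultrafilter_le_nhds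
      (Q.map fun v => μ.real (A ∩ U k v)) (s := Set.Icc (0 : ℝ) 1) (by
        rw [le_principal_iff]
        exact mem_map.2 (Eventually.of_forall fun v => ⟨measureReal_nonneg, measureReal_le_one⟩))
    have hy' : Tendsto (fun v => μ.real (A ∩ U k v)) Q (𝓝 y) := hy
    exact ⟨_, hy'.sub_const _⟩
  choose y hy using hlim
  have hdsymm : ∀ k k', d k k' = d k' k := fun k k' => by
    refine tendsto_nhds_unique (h2 k k') ?_
    simpa only [Set.inter_comm] using h2 k' k
  have hd1 : ∀ k k', d k k' ≤ 1 := fun k k' =>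
    le_of_tendsto (h2 k k') (Eventually.of_forall fun v => measureReal_le_one)
  have hy0 : Tendsto y q (𝓝 0) := by
    refine tendsto_zero_of_sq_sum_le (D := fun k k' => d k k' - c ^ 2) (C := 1)
      (fun k k' => by rw [hdsymm]) (fun k => by nlinarith [hd1 k k, sq_nonneg c]) ?_ ?_
    · intro s N
      have hl : Tendsto (fun v => (∑ i ∈ Finset.range N,
          (μ.real (A ∩ U (s i) v) - μ.real A * c)) ^ 2) Q
          (𝓝 ((∑ i ∈ Finset.range N, y (s i)) ^ 2)) :=
        (tendsto_finsetSum _ fun i _ => hy (s i)).pow 2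
      have hr : Tendsto (fun v => ∑ i ∈ Finset.range N, ∑ j ∈ Finset.range N,
          (μ.real (U (s i) v ∩ U (s j) v) - c * μ.real (U (s i) v) - c * μ.real (U (s j) v)
            + c ^ 2)) Q
          (𝓝 (∑ i ∈ Finset.range N, ∑ j ∈ Finset.range N,
            (d (s i) (s j) - c * c - c * c + c ^ 2))) :=
        tendsto_finsetSum _ fun i _ => tendsto_finsetSum _ fun j _ =>
          (((h2 _ _).sub ((h1 _).const_mul c)).sub ((h1 _).const_mul c)).add_const _
      have := le_of_tendsto_of_tendsto' hl hr fun v =>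
        sq_sum_measureReal_inter_sub_le μ hA (fun i => hU (s i) v) c N
      refine this.trans (le_of_eq (Finset.sum_congr rfl fun i _ => Finset.sum_congr rfl
        fun j _ => by ring))
    · intro δ hδ
      refine Eventually.of_forall fun k => ?_
      filter_upwards [(h3 k).eventually_lt_const (lt_add_of_pos_right _ hδ)] with k' hk'
      linarith
  filter_upwards [hy0.abs.eventually_lt_const (by simpa using hε)] with k hk
  exact (hy k).abs.eventually_lt_const hk

/-- A strongly mixing action is mixing of order `m` along iterated limits of sums `∑ t, h j t (k_t)`
whose pairwise differences go to infinity in each variable. By induction on `m`: for fixed `k_0`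
the remaining sums fall under the case `m - 1`, both for the sets `A j` and for the intersections
of two translates of `A j`, so the van der Corput trick applies in the variable `k_0`. -/
theorem StronglyMixing.tendsto_tupleUltrafilter [IsProbabilityMeasure μ]
    (hT : ∀ g : G, MeasurePreserving (fun x : X => g +ᵥ x) μ μ) (hmix : StronglyMixing G μ)
    (m : ℕ) (h : Fin (m + 1) → Fin m → ℕ → G)
    (hh : ∀ i j, i ≠ j → ∀ t, GoesToInfinity fun k => h i t k - h j t k)
    (A : Fin (m + 1) → Set X) (hA : ∀ j, MeasurableSet (A j)) :
    Tendsto (fun v : Fin m → ℕ => μ.real (⋂ j, (∑ t, h j t (v t)) +ᵥ A j))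
      (tupleUltrafilter m) (𝓝 (∏ j, μ.real (A j))) := by
  induction m with
  | zero => simp [show (⋂ j, A j) = A 0 from iInf_unique (ι := Fin 1) A]
  | succ m ih =>
    -- translating by the inverse of the `0`-th group element makes `A 0` stationary
    set b : Fin (m + 1) → ℕ → G := fun j k => h j.succ 0 k - h 0 0 k with hb
    set h' : Fin (m + 1) → Fin m → ℕ → G :=
      fun j t k => h j.succ t.succ k - h 0 t.succ k with hh'
    have hdiff : ∀ i j, i ≠ j → ∀ t, GoesToInfinity fun k => h' i t k - h' j t k := by
      intro i j hij t
      simpa only [hh', sub_sub_sub_cancel_right] using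
        hh i.succ j.succ (fun e => hij (Fin.succ_injective _ e)) t.succ
    set U : ℕ → (Fin m → ℕ) → Set X := fun k v =>
      ⋂ j : Fin (m + 1), (∑ t, h' j t (v t)) +ᵥ (b j k +ᵥ A j.succ) with hU
    have hbA : ∀ j k, MeasurableSet (b j k +ᵥ A j.succ) := fun j k =>
      measurableSet_vadd_set hT _ (hA _)
    have hrew : ∀ k (v : Fin m → ℕ),
        μ.real (⋂ j, (∑ t, h j t ((Fin.cons k v : Fin (m + 1) → ℕ) t)) +ᵥ A j) =
          μ.real (A 0 ∩ U k v) := by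
      intro k v
      have hset : (⋂ j, (∑ t, h j t ((Fin.cons k v : Fin (m + 1) → ℕ) t)) +ᵥ A j) =
          (∑ t, h 0 t ((Fin.cons k v : Fin (m + 1) → ℕ) t)) +ᵥ (A 0 ∩ U k v) := by
        rw [Set.vadd_set_inter, hU, Set.vadd_set_iInter]
        ext x
        simp only [Set.mem_iInter, Set.mem_inter_iff, Fin.forall_fin_succ (n := m + 1), vadd_vadd]
        refine and_congr Iff.rfl (forall_congr' fun j => ?_)
        have : (∑ t, h j.succ t ((Fin.cons k v : Fin (m + 1) → ℕ) t)) =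
            ∑ t, h 0 t ((Fin.cons k v : Fin (m + 1) → ℕ) t) +
              (∑ t, h' j t (v t) + b j k) := by
          simp only [hb, hh', Fin.sum_univ_succ, Fin.cons_zero, Fin.cons_succ,
            Finset.sum_sub_distrib]
          abel
        rw [this]
      rw [hset, measureReal_vadd_set hT]
      exact (hA 0).inter (MeasurableSet.iInter fun j => measurableSet_vadd_set hT _ (hbA j k))
    rw [Metric.tendsto_nhds]
    intro ε hε
    rw [eventually_tupleUltrafilter_succ]
    simp only [hrew, Fin.prod_univ_succ (n := m + 1), Real.dist_eq]
    refine tendsto_measureReal_inter_of_pairwise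
      (d := fun k k' => ∏ j : Fin (m + 1),
        μ.real ((b j k +ᵥ A j.succ) ∩ (b j k' +ᵥ A j.succ)))
      (fun k v => MeasurableSet.iInter fun j => measurableSet_vadd_set hT _ (hbA j k))
      (fun k => ?_) (fun k k' => ?_) (fun k => ?_) (hA 0) hε
    · have := ih h' hdiff (fun j => b j k +ᵥ A j.succ) fun j => hbA j k
      simpa only [measureReal_vadd_set hT _ (hA _)] using this
    · have := ih h' hdiff (fun j => (b j k +ᵥ A j.succ) ∩ (b j k' +ᵥ A j.succ))
        fun j => (hbA j k).inter (hbA j k')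
      simpa only [Set.vadd_set_inter, Set.iInter_inter_distrib] using this
    · rw [← Finset.prod_pow]
      refine tendsto_finsetProd _ fun j _ => ?_
      simp only [measureReal_vadd_inter_vadd hT _ _ (hA j.succ) (hA j.succ), sq]
      refine ((hmix _ _ (hA _) (hA _)).comp ?_).mono_left Nat.hyperfilter_le_atTop
      exact (sub_left_injective (b := b j k)).tendsto_cofinite.comp
        (hh j.succ 0 (Fin.succ_ne_zero j) 0)

/-! ### Approximation of the correlations -/

/-- Correlations depend on the sets in a Lipschitz way, uniformly in the group elements. -/
theorem abs_multiCorrelation_sub_le [IsProbabilityMeasure μ]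
    (hT : ∀ g : G, MeasurePreserving (fun x : X => g +ᵥ x) μ μ) {ℓ : ℕ}
    {A B : Fin (ℓ + 1) → Set X} (hA : ∀ j, MeasurableSet (A j)) (hB : ∀ j, MeasurableSet (B j))
    (g : Fin ℓ → G) :
    |multiCorrelation μ A g - multiCorrelation μ B g| ≤ ∑ j, μ.real (symmDiff (A j) (B j)) := by
  have hmeas : ∀ C : Fin (ℓ + 1) → Set X, (∀ j, MeasurableSet (C j)) →
      MeasurableSet (C 0 ∩ ⋂ j : Fin ℓ, (g j +ᵥ C j.succ)) := fun C hC =>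
    (hC 0).inter (MeasurableSet.iInter fun j => measurableSet_vadd_set hT _ (hC _))
  refine (abs_measureReal_sub_le_measureReal_symmDiff (hmeas A hA).nullMeasurableSet
    (hmeas B hB).nullMeasurableSet).trans ?_
  have hsub : symmDiff (A 0 ∩ ⋂ j : Fin ℓ, (g j +ᵥ A j.succ))
      (B 0 ∩ ⋂ j : Fin ℓ, (g j +ᵥ B j.succ)) ⊆
      symmDiff (A 0) (B 0) ∪ ⋃ j : Fin ℓ, (g j +ᵥ symmDiff (A j.succ) (B j.succ)) := by
    intro x hx
    simp only [Set.vadd_set_symmDiff, Set.mem_symmDiff, Set.mem_union, Set.mem_inter_iff,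
      Set.mem_iInter, Set.mem_iUnion] at hx ⊢
    by_contra hcon
    push Not at hcon
    obtain ⟨⟨h1, h2⟩, h3⟩ := hcon
    rcases hx with ⟨⟨ha, ha'⟩, hb⟩ | ⟨⟨ha, ha'⟩, hb⟩
    · exact hb ⟨h1 ha, fun j => (h3 j).1 (ha' j)⟩
    · exact hb ⟨h2 ha, fun j => (h3 j).2 (ha' j)⟩
  refine (measureReal_mono hsub).trans ((measureReal_union_le _ _).trans ?_)
  rw [Fin.sum_univ_succ]
  gcongr
  refine (measureReal_iUnion_fintype_le _).trans (le_of_eq ?_)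
  exact Finset.sum_congr rfl fun j _ => measureReal_vadd_set hT _ ((hA _).symmDiff (hB _))

/-! ### From mixing to multiple mixing along an infinite set -/

/-- The correlations of all sets converge along one common infinite `S`: the diagonal extraction
handles the countably many tuples from a measure-dense family, and the Lipschitz bound
`abs_multiCorrelation_sub_le` passes to arbitrary sets. -/
theorem StronglyMixing.exists_isRLim [IsProbabilityMeasure μ] [IsSeparable μ]
    (hT : ∀ g : G, MeasurePreserving (fun x : X => g +ᵥ x) μ μ) (hmix : StronglyMixing G μ)
    {ℓ : ℕ} (hℓ : 1 ≤ ℓ) (g : Fin ℓ → ℕ → Fin ℓ → G) (hg : ∀ j, NonDegenerated (g j))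
    (hgg : ∀ i j, i ≠ j → EssentiallyDistinct (g i) (g j)) :
    ∃ S : Set ℕ, S.Infinite ∧ ∀ A : Fin (ℓ + 1) → Set X, (∀ j, MeasurableSet (A j)) →
      IsRLim S (fun α : NatSubsets ℓ => multiCorrelation μ A (fun j => indexSum (g j) α))
        (∏ j, μ.real (A j)) := by
  -- the correlation along an arbitrary tuple of indices
  set x : (Fin (ℓ + 1) → Set X) → (Fin ℓ → ℕ) → ℝ := fun A v =>
    multiCorrelation μ A fun j => ∑ t, g j (v t) t with hx
  have hlim : ∀ A : Fin (ℓ + 1) → Set X, (∀ j, MeasurableSet (A j)) →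
      Tendsto (x A) (tupleUltrafilter ℓ) (𝓝 (∏ j, μ.real (A j))) := by
    intro A hA
    let h : Fin (ℓ + 1) → Fin ℓ → ℕ → G :=
      Fin.cons (fun _ _ => 0) fun j t k => g j k t
    have hh : ∀ i j, i ≠ j → ∀ t, GoesToInfinity fun k => h i t k - h j t k := by
      intro i j hij t
      induction i using Fin.cases with
      | zero =>
        induction j using Fin.cases with
        | zero => exact absurd rfl hij
        | succ j =>
          simpa [h, GoesToInfinity, Function.comp_def] using
            neg_injective.tendsto_cofinite.comp (hg j t)
      | succ i =>
        induction j using Fin.cases with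
        | zero => simpa [h] using hg i t
        | succ j => exact hgg i j (fun e => hij (congrArg _ e)) t
    have := hmix.tendsto_tupleUltrafilter hT ℓ h hh A hA
    refine this.congr fun v => ?_
    simp only [hx, multiCorrelation]
    congr 1
    ext z
    simp [Fin.forall_fin_succ (n := ℓ), h]
  obtain ⟨𝒜, h𝒜c, h𝒜⟩ := exists_countable_measureDense μ
  have : Countable 𝒜 := h𝒜c
  obtain ⟨B₀, hB₀⟩ := h𝒜.nonempty
  have : Nonempty (Fin (ℓ + 1) → 𝒜) := ⟨fun _ => ⟨B₀, hB₀⟩⟩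
  obtain ⟨e, he⟩ := exists_surjective_nat (Fin (ℓ + 1) → 𝒜)
  set E : ℕ → Fin (ℓ + 1) → Set X := fun n j => (e n j : Set X) with hE
  have hEm : ∀ n j, MeasurableSet (E n j) := fun n j => h𝒜.measurable _ (e n j).2
  obtain ⟨s, hs, hsP⟩ := exists_strictMono_forall_tuple (m := ℓ)
    (P := fun n v => ∀ i ∈ Finset.range (n + 1),
      |x (E i) v - ∏ j, μ.real (E i j)| < 1 / ((n : ℝ) + 1)) (by
      intro n
      refine (Filter.eventually_all_finset _).2 fun i _ => ?_
      have := Metric.tendsto_nhds.1 (hlim (E i) (hEm i)) (1 / ((n : ℝ) + 1)) (by positivity)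
      simpa only [Real.dist_eq] using this)
  refine ⟨Set.range s, Set.infinite_range_of_injective hs.injective, fun A hA ε hε => ?_⟩
  set δ : ℝ := ε / (3 * (ℓ + 1)) with hδ
  have hδ0 : 0 < δ := by positivity
  have happrox : ∀ j, ∃ B ∈ 𝒜, μ.real (symmDiff (A j) B) < δ := by
    intro j
    obtain ⟨B, hB, hAB⟩ := h𝒜.approx (A j) (hA j) (measure_ne_top _ _) δ hδ0
    refine ⟨B, hB, ?_⟩
    rw [measureReal_def]
    exact (ENNReal.toReal_lt_of_lt_ofReal hAB)
  choose B hB hAB using happrox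
  obtain ⟨i, hi⟩ := he fun j => ⟨B j, hB j⟩
  have hEB : E i = B := by
    ext1 j
    simp only [hE, hi]
  have hBm : ∀ j, MeasurableSet (B j) := fun j => h𝒜.measurable _ (hB j)
  have hclose : ∀ v, |x A v - x B v| ≤ ε / 3 := by
    intro v
    refine (abs_multiCorrelation_sub_le hT hA hBm _).trans ?_
    refine (Finset.sum_le_card_nsmul _ _ δ fun j _ => (hAB j).le).trans (le_of_eq ?_)
    simp [hδ]
    field_simp
  -- the limits inherit the distance bound of the correlations
  have hprod : |∏ j, μ.real (A j) - ∏ j, μ.real (B j)| ≤ ε / 3 :=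
    le_of_tendsto ((hlim A hA).sub (hlim B hBm)).abs (Eventually.of_forall hclose)
  obtain ⟨N, hN⟩ := exists_nat_one_div_lt (show 0 < ε / 3 by positivity)
  set n := max i N
  refine ⟨OrderEmbedding.ofStrictMono (fun t : Fin ℓ => s n + t) fun a b hab => by
    simpa using hab, fun α hαs hα => ?_⟩
  have hsmall : |x B α - ∏ j, μ.real (B j)| < ε / 3 := by
    rw [← hEB]
    refine (hsP n α α.strictMono hαs (fun t => ?_) i
      (Finset.mem_range.2 (Nat.lt_succ_of_le (le_max_left _ _)))).trans_le (le_trans ?_ hN.le)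
    · exact (Nat.le_add_right (s n) 0).trans (hα ⟨0, hℓ⟩ t).le
    · have : (N : ℝ) ≤ n := by exact_mod_cast le_max_right i N
      gcongr
  have hfin : |x A α - ∏ j, μ.real (A j)| < ε := by
    have h1 := abs_le.1 (hclose α)
    have h2 := abs_le.1 hprod
    have h3 := abs_lt.1 hsmall
    rw [abs_lt]
    constructor <;> linarith [h1.1, h1.2, h2.1, h2.2, h3.1, h3.2]
  exact hfin

end Action

/-! ### Sequences that grow apart -/

section GrowApart

variable {G : Type*} [AddCommGroup G]

theorem GoesToInfinity.neg {g : ℕ → G} (hg : GoesToInfinity g) : GoesToInfinity fun k => -g k :=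
  neg_injective.tendsto_cofinite.comp hg

theorem GrowApart.symm {g h : ℕ → G} (hgh : GrowApart g h) : GrowApart h g := by
  simpa only [GrowApart, neg_sub] using GoesToInfinity.neg hgh

theorem GoesToInfinity.infinite {G : Type*} {g : ℕ → G} (hg : GoesToInfinity g) : Infinite G := by
  by_contra hfin
  rw [not_infinite_iff_finite] at hfin
  obtain ⟨k, hk⟩ := (hg.eventually Set.finite_univ.eventually_cofinite_notMem).exists
  exact hk (Set.mem_univ _)

/-- In a countable infinite group there is a sequence going to infinity that grows apart from
finitely many given sequences. -/
theorem exists_goesToInfinity_growApart [Countable G] [Infinite G] (F : Finset (ℕ → G)) :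
    ∃ v : ℕ → G, GoesToInfinity v ∧ ∀ u ∈ F, GrowApart u v := by
  obtain ⟨e, he⟩ := exists_surjective_nat G
  have hk : ∀ k : ℕ, ∃ x : G, ∀ i ∈ Finset.range (k + 1), x ≠ e i ∧ ∀ u ∈ F, u k - x ≠ e i := by
    intro k
    have : ∀ᶠ x in (cofinite : Filter G), ∀ i ∈ Finset.range (k + 1),
        x ≠ e i ∧ ∀ u ∈ F, u k - x ≠ e i := by
      refine (Filter.eventually_all_finset _).2 fun i _ => (eventually_cofinite_ne (e i)).and
        ((Filter.eventually_all_finset _).2 fun u _ => ?_)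
      filter_upwards [eventually_cofinite_ne (u k - e i)] with x hx h
      exact hx (by rw [← h]; abel)
    exact this.exists
  choose v hv using hk
  refine ⟨v, le_cofinite_iff_eventually_ne.2 fun x => ?_,
    fun u hu => le_cofinite_iff_eventually_ne.2 fun x => ?_⟩
  · obtain ⟨i, rfl⟩ := he x
    refine (eventually_ge_atTop i).mono fun k hk => ?_
    exact (hv k i (Finset.mem_range.2 (Nat.lt_succ_of_le hk))).1
  · obtain ⟨i, rfl⟩ := he x
    refine (eventually_ge_atTop i).mono fun k hk => ?_
    exact (hv k i (Finset.mem_range.2 (Nat.lt_succ_of_le hk))).2 u hu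

/-- Every sequence going to infinity is the `0`-th coordinate of a non-degenerated sequence in a
power of `G` whose coordinates pairwise grow apart. -/
theorem GoesToInfinity.exists_nonDegenerated [Countable G] {u : ℕ → G} (hu : GoesToInfinity u)
    (d : ℕ) : ∃ w : ℕ → Fin (d + 1) → G, (∀ k, w k 0 = u k) ∧ NonDegenerated w ∧
      ∀ t t' : Fin (d + 1), t ≠ t' → GrowApart (fun k => w k t) (fun k => w k t') := by
  classical
  have : Infinite G := hu.infinite
  obtain ⟨f, hf, hff⟩ := exists_seq_of_forall_finset_exists
    (fun v : ℕ → G => GoesToInfinity v ∧ GrowApart u v) GrowApart (by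
      intro F _
      obtain ⟨v, hv, hFv⟩ := exists_goesToInfinity_growApart (insert u F)
      exact ⟨v, ⟨hv, hFv u (Finset.mem_insert_self u F)⟩,
        fun x hx => hFv x (Finset.mem_insert_of_mem hx)⟩)
  refine ⟨fun k => Fin.cons (u k) fun t => f t k, fun k => rfl, ?_, ?_⟩
  · intro t
    induction t using Fin.cases with
    | zero => exact hu
    | succ t => exact (hf t).1
  · intro t t' htt'
    induction t using Fin.cases with
    | zero =>
      induction t' using Fin.cases with
      | zero => exact absurd rfl htt'
      | succ t' => exact (hf t').2
    | succ t =>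
      induction t' using Fin.cases with
      | zero => exact (hf t).2.symm
      | succ t' =>
        have hne : (t : ℕ) ≠ t' := fun e => htt' (congrArg _ (Fin.ext e))
        rcases hne.lt_or_gt with h | h
        · exact hff _ _ h
        · exact (hff _ _ h).symm

end GrowApart

/-! ### Mixing along ultrafilters -/

section UltrafilterSums

attribute [local instance] Ultrafilter.addSemigroup

/-- The ultrafilters on `G` of the form `p₁ + ⋯ + pₘ`, where each `pᵢ` is the image of the
hyperfilter on `ℕ` under a sequence going to infinity. -/
def sumUltrafilters (G : Type*) [AddCommGroup G] : ℕ → Set (Ultrafilter G)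
  | 0 => {pure 0}
  | m + 1 => {r | ∃ g : ℕ → G, GoesToInfinity g ∧
      ∃ r' ∈ sumUltrafilters G m, r = (hyperfilter ℕ).map g + r'}

/-- Strong mixing along a filter `r` on the group. -/
def MixesAlong {G : Type*} [AddCommGroup G] {X : Type*} [MeasurableSpace X] [AddAction G X]
    (μ : Measure X) (r : Filter G) : Prop :=
  ∀ A B : Set X, MeasurableSet A → MeasurableSet B →
    Tendsto (fun g : G => μ.real (A ∩ (g +ᵥ B))) r (𝓝 (μ.real A * μ.real B))

variable {G : Type*} [AddCommGroup G]

theorem pure_zero_add_ultrafilter (r : Ultrafilter G) : pure 0 + r = r := by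
  refine Ultrafilter.coe_injective (Filter.ext' fun p => ?_)
  rw [Ultrafilter.eventually_add, Ultrafilter.coe_pure, eventually_pure]
  simp only [zero_add]

theorem add_mem_sumUltrafilters {m n : ℕ} {r r' : Ultrafilter G} (hr : r ∈ sumUltrafilters G m)
    (hr' : r' ∈ sumUltrafilters G n) : r + r' ∈ sumUltrafilters G (m + n) := by
  induction m generalizing r with
  | zero =>
    obtain rfl : r = pure 0 := hr
    rwa [pure_zero_add_ultrafilter, zero_add]
  | succ m ih =>
    obtain ⟨g, hg, r₁, hr₁, rfl⟩ := hr
    rw [Nat.add_right_comm, add_assoc (_ : Ultrafilter G)]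
    exact ⟨g, hg, _, ih hr₁, rfl⟩

theorem map_neg_mem_sumUltrafilters {m : ℕ} {r : Ultrafilter G} (hr : r ∈ sumUltrafilters G m) :
    r.map (fun x => -x) ∈ sumUltrafilters G m := by
  induction m generalizing r with
  | zero =>
    obtain rfl : r = pure 0 := hr
    refine Ultrafilter.coe_injective (Filter.ext' fun p => ?_)
    simp
  | succ m ih =>
    obtain ⟨g, hg, r₁, hr₁, rfl⟩ := hr
    refine ⟨_, hg.neg, _, ih hr₁, Ultrafilter.coe_injective (Filter.ext' fun p => ?_)⟩
    simp only [Ultrafilter.eventually_add, Ultrafilter.coe_map, eventually_map, neg_add]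

theorem exists_eventually_iff_of_mem_sumUltrafilters {m : ℕ} {r : Ultrafilter G}
    (hr : r ∈ sumUltrafilters G m) : ∃ g : Fin m → ℕ → G, (∀ j, GoesToInfinity (g j)) ∧
      ∀ p : G → Prop, (∀ᶠ x in (r : Filter G), p x) ↔
        ∀ᶠ v in (tupleUltrafilter m : Filter (Fin m → ℕ)), p (∑ j, g j (v j)) := by
  induction m generalizing r with
  | zero =>
    obtain rfl : r = pure 0 := hr
    exact ⟨fun j => j.elim0, fun j => j.elim0, fun p => by simp⟩
  | succ m ih =>
    obtain ⟨g, hg, r₁, hr₁, rfl⟩ := hr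
    obtain ⟨g₁, hg₁, hiff⟩ := ih hr₁
    refine ⟨Fin.cons g g₁, Fin.cases hg hg₁, fun p => ?_⟩
    rw [Ultrafilter.eventually_add, eventually_tupleUltrafilter_succ, Ultrafilter.coe_map,
      eventually_map]
    refine eventually_congr (Eventually.of_forall fun k => ?_)
    rw [hiff]
    simp [Fin.sum_univ_succ]

variable {X : Type*} [MeasurableSpace X] {μ : Measure X} [AddAction G X]

/-- If all sets of `ε`-independence are `Σ_ℓ^*`, the action mixes along every sum of `ℓ`
ultrafilters coming from sequences: otherwise the diagonal extraction produces a `Σ_ℓ` set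
consisting of bad elements only. -/
theorem mixesAlong_of_isSigmaStarSet {ℓ : ℕ}
    (h : ∀ ε : ℝ, 0 < ε → ∀ A₀ A₁ : Set X, MeasurableSet A₀ → MeasurableSet A₁ →
      IsSigmaStarSet ℓ {g : G | |μ.real (A₀ ∩ (g +ᵥ A₁)) - μ.real A₀ * μ.real A₁| < ε})
    {r : Ultrafilter G} (hr : r ∈ sumUltrafilters G ℓ) : MixesAlong μ (r : Filter G) := by
  intro A B hA hB
  rw [Metric.tendsto_nhds]
  intro ε hε
  by_contra hcon
  rw [← Ultrafilter.eventually_not] at hcon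
  obtain ⟨g, hg, hiff⟩ := exists_eventually_iff_of_mem_sumUltrafilters hr
  rw [hiff] at hcon
  obtain ⟨s, hs, hsP⟩ := exists_strictMono_forall_tuple fun _ : ℕ => hcon
  obtain ⟨x, hx, k, rfl⟩ := h ε hε A B hA hB
    {x | ∃ k : NatSubsets ℓ, x = ∑ j, g j (s (k j))}
    ⟨fun j i => g j (s i), fun j => (hg j).comp hs.tendsto_atTop, rfl⟩
  refine hsP 0 (fun j => s (k j)) (hs.comp k.strictMono) (fun j => ⟨_, rfl⟩)
    (fun j => hs.monotone (Nat.zero_le _)) ?_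
  rwa [Real.dist_eq]

theorem MixesAlong.add_left (hT : ∀ g : G, MeasurePreserving (fun x : X => g +ᵥ x) μ μ)
    {r : Ultrafilter G} (hr : MixesAlong μ (r : Filter G)) (p : Ultrafilter G) :
    MixesAlong μ ((p + r : Ultrafilter G) : Filter G) := by
  intro A B hA hB
  rw [Metric.tendsto_nhds]
  intro ε hε
  rw [Ultrafilter.eventually_add]
  refine Eventually.of_forall fun a => ?_
  have := Metric.tendsto_nhds.1 (hr _ B (measurableSet_vadd_set hT (-a) hA) hB) ε hε
  simpa only [measureReal_vadd_inter_vadd hT (-a) _ hA hB, measureReal_vadd_set hT _ hA,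
    sub_neg_eq_add, add_comm] using this

/-- Mixing along `-r + r` forces mixing along `r`, by the van der Corput trick. -/
theorem MixesAlong.of_neg_add [IsProbabilityMeasure μ]
    (hT : ∀ g : G, MeasurePreserving (fun x : X => g +ᵥ x) μ μ) {r : Ultrafilter G}
    (hr : MixesAlong μ ((r.map (fun x => -x) + r : Ultrafilter G) : Filter G)) :
    MixesAlong μ (r : Filter G) := by
  intro A B hA hB
  have hB' : ∀ g : G, MeasurableSet (g +ᵥ B) := fun g => measurableSet_vadd_set hT g hB
  have hreal : ∀ g : G, μ.real (g +ᵥ B) = μ.real B := fun g => measureReal_vadd_set hT g hB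
  have h0 : Tendsto (fun g : G => μ.real (A ∩ (g +ᵥ B)) - μ.real A * μ.real B) r (𝓝 0) := by
    refine tendsto_zero_of_sq_sum_le
      (D := fun a b => μ.real ((a +ᵥ B) ∩ (b +ᵥ B)) - μ.real B ^ 2) (C := 1)
      (fun a b => by rw [Set.inter_comm]) (fun a => ?_) (fun s N => ?_) (fun ε hε => ?_)
    · linarith [measureReal_le_one (μ := μ) (s := (a +ᵥ B) ∩ (a +ᵥ B)), sq_nonneg (μ.real B)]
    · refine (sq_sum_measureReal_inter_sub_le μ hA (fun i => hB' (s i)) (μ.real B) N).trans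
        (le_of_eq (Finset.sum_congr rfl fun i _ => Finset.sum_congr rfl fun j _ => ?_))
      rw [hreal, hreal]
      ring
    · have := (hr B B hB hB).eventually_lt_const (lt_add_of_pos_right _ hε)
      rw [Ultrafilter.eventually_add, Ultrafilter.coe_map, eventually_map] at this
      refine this.mono fun a ha => ha.mono fun b hb => ?_
      rw [measureReal_vadd_inter_vadd hT a b hB hB, sq, sub_lt_iff_lt_add', sub_eq_neg_add b a]
      exact hb
  simpa using h0.add_const (μ.real A * μ.real B)

/-- Mixing along all sums of `ℓ ≥ 1` ultrafilters is strong mixing: the number of summands can be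
lowered one at a time, because `-r + r` has at least `m + 1` summands if `r` has `m ≥ 1`. -/
theorem stronglyMixing_of_mixesAlong [IsProbabilityMeasure μ]
    (hT : ∀ g : G, MeasurePreserving (fun x : X => g +ᵥ x) μ μ) {ℓ : ℕ} (hℓ : 1 ≤ ℓ)
    (h : ∀ r ∈ sumUltrafilters G ℓ, MixesAlong μ (r : Filter G)) : StronglyMixing G μ := by
  have hup : ∀ m n, (∀ r ∈ sumUltrafilters G m, MixesAlong μ (r : Filter G)) →
      ∀ r ∈ sumUltrafilters G (m + n), MixesAlong μ (r : Filter G) := by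
    intro m n hm
    induction n with
    | zero => exact hm
    | succ n ih =>
      rintro r ⟨g, -, r', hr', rfl⟩
      exact (ih r' hr').add_left hT _
  have hone : ∀ r ∈ sumUltrafilters G 1, MixesAlong μ (r : Filter G) := by
    induction ℓ, hℓ using Nat.le_induction with
    | base => exact h
    | succ m hm ih =>
      refine ih fun r hr => MixesAlong.of_neg_add hT ?_
      obtain ⟨n, hn⟩ := Nat.exists_eq_add_of_le (show m + 1 ≤ m + m by omega)
      have := add_mem_sumUltrafilters (map_neg_mem_sumUltrafilters hr) hr
      rw [hn] at this
      exact hup (m + 1) n h _ this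
  intro A B hA hB
  by_contra hcon
  rw [Metric.tendsto_nhds] at hcon
  push Not at hcon
  obtain ⟨ε, hε, hfreq⟩ := hcon
  have hinf := frequently_cofinite_iff_infinite.1 hfreq
  -- a sequence of distinct elements violating the `ε`-estimate
  set g : ℕ → G := fun k => hinf.natEmbedding _ k
  have hg : GoesToInfinity g := by
    rw [GoesToInfinity, ← Nat.cofinite_eq_atTop]
    exact (Subtype.val_injective.comp (hinf.natEmbedding _).injective).tendsto_cofinite
  have hbad : ∀ k, ε ≤ dist (μ.real (A ∩ (g k +ᵥ B))) (μ.real A * μ.real B) := fun k =>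
    (hinf.natEmbedding _ k).2
  have hmem : (hyperfilter ℕ).map g + pure 0 ∈ sumUltrafilters G 1 := ⟨g, hg, pure 0, rfl, rfl⟩
  have := Metric.tendsto_nhds.1 (hone _ hmem A B hA hB) ε hε
  rw [Ultrafilter.eventually_add, Ultrafilter.coe_map, eventually_map] at this
  obtain ⟨k, hk⟩ := this.exists
  simp only [Ultrafilter.coe_pure, eventually_pure, add_zero] at hk
  exact absurd hk (hbad k).not_gt

end UltrafilterSums

/-! ### The equivalence -/

theorem theorem3 (ℓ : ℕ) (hℓ : 1 ≤ ℓ) {G : Type*} [AddCommGroup G] [Countable G]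
    {X : Type*} [MeasurableSpace X] (μ : Measure X) [IsProbabilityMeasure μ] [IsSeparable μ]
    [AddAction G X] (hT : ∀ g : G, MeasurePreserving (fun x : X => g +ᵥ x) μ μ) :
    List.TFAE [
      StronglyMixing G μ,
      ∀ g : Fin ℓ → ℕ → Fin ℓ → G, (∀ j, NonDegenerated (g j)) →
        (∀ i j, i ≠ j → EssentiallyDistinct (g i) (g j)) →
        ∃ S : Set ℕ, S.Infinite ∧ ∀ A : Fin (ℓ + 1) → Set X, (∀ j, MeasurableSet (A j)) →
          IsRLim S (fun α : NatSubsets ℓ => multiCorrelation μ A (fun j => indexSum (g j) α))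
            (∏ j, μ.real (A j)),
      ∀ ε : ℝ, 0 < ε → ∀ A : Fin (ℓ + 1) → Set X, (∀ j, MeasurableSet (A j)) →
        IsSigmaTildeStarSet ℓ (mixingSet G μ ε A),
      ∀ ε : ℝ, 0 < ε → ∀ A₀ A₁ : Set X, MeasurableSet A₀ → MeasurableSet A₁ →
        IsSigmaStarSet ℓ {g : G | |μ.real (A₀ ∩ (g +ᵥ A₁)) - μ.real A₀ * μ.real A₁| < ε}] := by
  tfae_have 1 → 2 := fun hmix g hg hgg => hmix.exists_isRLim hT hℓ g hg hgg
  tfae_have 2 → 3 := by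
    rintro h ε hε A hA D ⟨g, hg, hgg, rfl⟩
    -- transpose the roles of sequence index and coordinate
    obtain ⟨S, hS, hlim⟩ := h (fun t k j => g j k t) (fun t j => hg j t)
      (fun t t' htt' j => hgg j t t' htt')
    obtain ⟨α₀, hα₀⟩ := hlim A hA ε hε
    -- an element of `S^(ℓ)` beyond `α₀`
    set N := Finset.univ.sup α₀
    have hS' : (S \ Set.Iic N).Infinite := hS.sdiff (Set.finite_Iic N)
    let α : NatSubsets ℓ := OrderEmbedding.ofStrictMono
      (fun t : Fin ℓ => Nat.nth (· ∈ S \ Set.Iic N) t) fun a b hab => Nat.nth_strictMono hS' hab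
    have hα : ∀ t, α t ∈ S \ Set.Iic N := fun t => Nat.nth_mem_of_infinite hS' _
    refine ⟨fun t => ∑ j, g j (α j) t, ?_, α, ?_⟩
    · have := hα₀ α (fun t => (hα t).1) fun i t =>
        (Finset.le_sup (Finset.mem_univ i)).trans_lt (not_le.1 (hα t).2)
      rwa [Real.dist_eq] at this
    · ext t
      rw [Finset.sum_apply]
  tfae_have 3 → 4 := by
    rintro h ε hε A₀ A₁ hA₀ hA₁ D ⟨g, hg, rfl⟩
    obtain ⟨d, rfl⟩ : ∃ d, ℓ = d + 1 := ⟨ℓ - 1, by omega⟩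
    choose w hw0 hw hww using fun j => (hg j).exists_nonDegenerated d
    -- the correlations of `A₀, A₁, X, …, X` only see the first coordinate
    let A : Fin (d + 1 + 1) → Set X := Fin.cons A₀ (Fin.cons A₁ fun _ => Set.univ)
    have hA : ∀ j, MeasurableSet (A j) :=
      Fin.cases hA₀ (Fin.cases hA₁ fun _ => MeasurableSet.univ)
    obtain ⟨x, hx, k, rfl⟩ := h ε hε A hA _ ⟨w, hw, hww, rfl⟩
    refine ⟨∑ j, g j (k j), ?_, k, rfl⟩
    have hset : A 0 ∩ ⋂ j : Fin (d + 1), ((∑ i, w i (k i)) j +ᵥ A j.succ) =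
        A₀ ∩ ((∑ j, g j (k j)) +ᵥ A₁) := by
      ext z
      simp [A, Fin.forall_fin_succ (n := d), Finset.sum_apply, hw0]
    have hprod : ∏ j, μ.real (A j) = μ.real A₀ * μ.real A₁ := by
      simp [A, Fin.prod_univ_succ]
    rw [mixingSet, Set.mem_ofPred_eq, multiCorrelation, hset, hprod] at hx
    exact hx
  tfae_have 4 → 1 := fun h =>
    stronglyMixing_of_mixesAlong hT hℓ fun r hr => mixesAlong_of_isSigmaStarSet h hr
  tfae_finish
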